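/- Let $n\ge 1$. Let $\mathbb H^n$ be the real vector space of Hermitian $n\times n$ matrices, $\Lambda_1(A)$ the smallest eigenvalue of $A\in\mathbb H^n$, and $\mathcal C_n=\{P\in\mathbb H^n: P>0\}$ the positive definite matrices. Assume: a) $\mathcal C\subset\mathbb H^n$ is an open cone ($tA\in\mathcal C$ for all $t>0$, $A\in\mathcal C$) with $\mathcal C_n\subset\mathcal C$; b) $G:\overline{\mathcal C}\to\mathbb R$ is continuous; c) there is a constant $C>0$ such that for all $A\in\mathcal C$ and $P\in\mathcal C_n$ one has $A+P\in\overline{\mathcal C}$ and $$G(A+P)-G(A)\ge C\,\Lambda_1(P).$$ Let $\Omega\subset\mathbb C^n$ be a bounded domain (nonempty, open and connected), let $f:\overline\Omega\to\mathbb R$ be continuous and positive, and consider the equation $$G(D^2_{\mathbb C}u)=f\quad\text{in }\Omega,\qquad D^2_{\mathbb C}u=\Big(\frac{\partial^2u}{\partial z_j\,\partial\bar z_k}\Big)_{1\le j,k\le n}.$$ A real-valued upper semicontinuous function $u$ on $\Omega$ is a viscosity subsolution if, for every $z_0\in\Omega$ and every real function $\varphi$ of class $C^2$ near $z_0$ with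 $\varphi(z_0)=u(z_0)$ and $\varphi\ge u$ near $z_0$, one has $D^2_{\mathbb C}\varphi(z_0)\in\overline{\mathcal C}$ and $G(D^2_{\mathbb C}\varphi(z_0))\ge f(z_0)$. A real-valued lower semicontinuous function $v$ on $\Omega$ is a viscosity supersolution if, for every $z_0\in\Omega$ and every real function $\psi$ of class $C^2$ near $z_0$ with $\psi(z_0)=v(z_0)$, $\psi\le v$ near $z_0$ and $D^2_{\mathbb C}\psi(z_0)\in\overline{\mathcal C}$, one has $G(D^2_{\mathbb C}\psi(z_0))\le f(z_0)$. Let $u$ be upper semicontinuous and $v$ lower semicontinuous on $\overline\Omega$, both real-valued and bounded, such that $u$ is a viscosity subsolution and $v$ a viscosity supersolution in $\Omega$. If $u\le v$ on $\partial\Omega$, then $u\le v$ in $\Omega$. -/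

import Mathlib

open Set Filter Topology
open scoped ComplexOrder

noncomputable section

/-- Complex Euclidean space `ℂⁿ`. -/
abbrev Cn (n : ℕ) : Type := EuclideanSpace ℂ (Fin n)

/-- The real vector space of Hermitian `n × n` matrices, with its usual topology. -/
abbrev Herm (n : ℕ) : Type := selfAdjoint (Matrix (Fin n) (Fin n) ℂ)

/-- `Λ₁(A)`, the smallest eigenvalue of a Hermitian matrix (`n ≥ 1` is assumed wherever it is
used, so this is a minimum over a finite nonempty family). -/
def lambdaOne {n : ℕ} (A : Herm n) : ℝ :=
  ⨅ i, (show (A : Matrix (Fin n) (Fin n) ℂ).IsHermitian from A.2).eigenvalues i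

/-- The real second derivative `∂_a ∂_b φ (z)` in the directions `a, b ∈ ℂⁿ = ℝ²ⁿ`. -/
def realD2 {n : ℕ} (φ : Cn n → ℝ) (z a b : Cn n) : ℝ :=
  fderiv ℝ (fderiv ℝ φ) z a b

/-- The standard basis vector `e_j`, i.e. the direction of `x_j = Re z_j`. -/
def dirX {n : ℕ} (j : Fin n) : Cn n := EuclideanSpace.single j (1 : ℂ)

/-- The vector `i e_j`, i.e. the direction of `y_j = Im z_j`. -/
def dirY {n : ℕ} (j : Fin n) : Cn n := EuclideanSpace.single j Complex.I

/-- The complex Hessian matrix `(∂²φ / ∂z_j ∂z̄_k)_{j,k}` at `z`, with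
`∂/∂z_j = (∂/∂x_j - i ∂/∂y_j) / 2` and `∂/∂z̄_k = (∂/∂x_k + i ∂/∂y_k) / 2` multiplied out. -/
def complexHessianMatrix {n : ℕ} (φ : Cn n → ℝ) (z : Cn n) : Matrix (Fin n) (Fin n) ℂ :=
  Matrix.of fun j k =>
    (1 / 4 : ℂ) *
      (((realD2 φ z (dirX j) (dirX k) + realD2 φ z (dirY j) (dirY k) : ℝ) : ℂ)
        + Complex.I *
          ((realD2 φ z (dirX j) (dirY k) - realD2 φ z (dirY j) (dirX k) : ℝ) : ℂ))

theorem realD2_symm {n : ℕ} {φ : Cn n → ℝ} {z : Cn n} (h : ContDiffAt ℝ 2 φ z)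
    (a b : Cn n) : realD2 φ z a b = realD2 φ z b a :=
  (h.isSymmSndFDerivAt (by simp)).eq a b

theorem complexHessianMatrix_isSelfAdjoint {n : ℕ} {φ : Cn n → ℝ} {z : Cn n}
    (h : ContDiffAt ℝ 2 φ z) :
    complexHessianMatrix φ z ∈ selfAdjoint (Matrix (Fin n) (Fin n) ℂ) := by
  rw [selfAdjoint.mem_iff, Matrix.star_eq_conjTranspose]
  ext j k
  rw [Matrix.conjTranspose_apply]
  simp only [complexHessianMatrix, Matrix.of_apply]
  rw [realD2_symm h (dirX k) (dirX j), realD2_symm h (dirY k) (dirY j),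
    realD2_symm h (dirX k) (dirY j), realD2_symm h (dirY k) (dirX j)]
  apply Complex.ext <;> simp

/-- `D²_ℂ φ (z)` for a real function `φ` that is `C²` near `z`, as a Hermitian matrix. -/
def complexHessian {n : ℕ} (φ : Cn n → ℝ) (z : Cn n) (h : ContDiffAt ℝ 2 φ z) : Herm n :=
  ⟨complexHessianMatrix φ z, complexHessianMatrix_isSelfAdjoint h⟩

/-- `φ` touches `u` from above at `z₀`. -/
def TouchesFromAbove {n : ℕ} (φ u : Cn n → ℝ) (z₀ : Cn n) : Prop :=
  φ z₀ = u z₀ ∧ ∀ᶠ z in 𝓝 z₀, u z ≤ φ z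

/-- `φ` touches `u` from below at `z₀`. -/
def TouchesFromBelow {n : ℕ} (φ u : Cn n → ℝ) (z₀ : Cn n) : Prop :=
  φ z₀ = u z₀ ∧ ∀ᶠ z in 𝓝 z₀, φ z ≤ u z

/-- `u` is a (real-valued) viscosity subsolution of `G(D²_ℂ u) = f` in the open set `Ω`. The
operator `G` lives on `closure 𝒞` and counts as `-∞` elsewhere, so that `G(D²_ℂ φ) ≥ f`
includes `D²_ℂ φ ∈ closure 𝒞`. Only the values of `u` and `f` in `Ω` matter. -/
structure IsViscositySubsolution {n : ℕ} (𝒞 : Set (Herm n)) (G : Herm n → ℝ)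
    (f : Cn n → ℝ) (Ω : Set (Cn n)) (u : Cn n → ℝ) : Prop where
  usc : UpperSemicontinuousOn u Ω
  test : ∀ z₀ ∈ Ω, ∀ (φ : Cn n → ℝ) (hφ : ContDiffAt ℝ 2 φ z₀), TouchesFromAbove φ u z₀ →
    complexHessian φ z₀ hφ ∈ closure 𝒞 ∧ f z₀ ≤ G (complexHessian φ z₀ hφ)

/-- `v` is a (real-valued) viscosity supersolution of `G(D²_ℂ v) = f` in the open set `Ω`. -/
structure IsViscositySupersolution {n : ℕ} (𝒞 : Set (Herm n)) (G : Herm n → ℝ)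
    (f : Cn n → ℝ) (Ω : Set (Cn n)) (v : Cn n → ℝ) : Prop where
  lsc : LowerSemicontinuousOn v Ω
  test : ∀ z₀ ∈ Ω, ∀ (ψ : Cn n → ℝ) (hψ : ContDiffAt ℝ 2 ψ z₀), TouchesFromBelow ψ v z₀ →
    complexHessian ψ z₀ hψ ∈ closure 𝒞 → G (complexHessian ψ z₀ hψ) ≤ f z₀

end

/-! If `u - v` were positive somewhere, adding `δ‖z‖²` to `u` would keep the maximum of the
difference away from the boundary and gain a definite amount of ellipticity. Doubling variables
should then contradict the two viscosity inequalities at nearby points `y`, `y'`, since `f` is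
continuous.

The doubling penalises through a third point `x`, that is, it compares a sup-convolution `U` with an
inf-convolution `V`. After adding `l/2‖z‖²`, `U` becomes convex and `V` semiconcave. A single
function `H`, both convex and semiconcave, fits between them up to affine terms
(`exists_convex_semiconcave_between`). Its gradient is Lipschitz, so Rademacher's theorem gives
second-order expansions almost everywhere. Maximum points depend antilipschitzly on the linear
perturbation, so some small slope has its maximum at such a point. There `H` supplies one and the
same second-order part for both functions (`exists_common_second_order_jet`), and no matrix
inequality has to be derived. -/

/-! ### Measure of antilipschitz images -/

open MeasureTheory in
/-- The value set of an antilipschitz selection over a ball is not Lebesgue-null. -/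
theorem exists_mem_ball_of_antilipschitz {E : Type*} [NormedAddCommGroup E]
    [InnerProductSpace ℝ E] [FiniteDimensional ℝ E] [MeasurableSpace E] [BorelSpace E]
    {K : NNReal} {g : E → E} (hg : AntilipschitzWith K g) {r : ℝ} (hr : 0 < r) {D : E → Prop}
    (hD : ∀ᵐ x ∂(μH[Module.finrank ℝ E] : Measure E), D x) :
    ∃ p ∈ Metric.ball (0 : E) r, D (g p) := by
  by_contra! hcon
  have h0 : (μH[Module.finrank ℝ E] : Measure E) (g '' Metric.ball 0 r) = 0 := by
    refine measure_mono_null ?_ hD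
    rintro _ ⟨p, hp, rfl⟩
    exact hcon p hp
  have h1 := hg.le_hausdorffMeasure_image (d := Module.finrank ℝ E) (by positivity)
    (Metric.ball (0 : E) r)
  rw [h0, mul_zero] at h1
  exact (Metric.measure_ball_pos (μH[Module.finrank ℝ E] : Measure E) (0 : E) hr).not_ge h1

/-! ### Convex and semiconcave functions -/

section Convex

variable {E : Type*} [NormedAddCommGroup E] [InnerProductSpace ℝ E]

local notation "⟪" x ", " y "⟫" => inner ℝ x y

/-- A finite convex function on a finite-dimensional space has a subgradient everywhere. -/
theorem ConvexOn.exists_subgradient [FiniteDimensional ℝ E] {H : E → ℝ}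
    (hH : ConvexOn ℝ univ H) (x : E) : ∃ p : E, ∀ z, H x + ⟪p, z - x⟫ ≤ H z := by
  have hc : Continuous H := continuousOn_univ.1 (hH.continuousOn isOpen_univ)
  have hconv : Convex ℝ {q : E × ℝ | H q.1 < q.2} := by
    simpa using hH.convex_strict_epigraph
  have hopen : IsOpen {q : E × ℝ | H q.1 < q.2} :=
    isOpen_lt (hc.comp continuous_fst) continuous_snd
  -- The separating hyperplane is not vertical, because the epigraph contains points right above
  -- `(x, H x)`. Dividing by its vertical coefficient gives the slope.
  obtain ⟨l, hl⟩ := geometric_hahn_banach_point_open (x := (x, H x)) hconv hopen (by simp)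
  have hdec : ∀ z t, l (z, t) = l (z, 0) + t * l (0, 1) := fun z t => by
    rw [← smul_eq_mul, ← map_smul, ← map_add]; simp
  have hpos : 0 < l (0, 1) := by
    have := hl (x, H x + 1) (by simp)
    rw [hdec x (H x), hdec x (H x + 1)] at this
    linarith
  let m : E →L[ℝ] ℝ := l.comp (ContinuousLinearMap.inl ℝ E ℝ)
  refine ⟨-(l (0, 1))⁻¹ • (InnerProductSpace.toDual ℝ E).symm m, fun z => ?_⟩
  have hle : l (x, H x) ≤ l (z, H z) := by
    refine le_of_forall_pos_lt_add fun ε hε => ?_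
    have := hl (z, H z + ε / l (0, 1)) (by simp; positivity)
    rw [hdec z] at this
    rw [hdec z (H z)]
    have h2 : (H z + ε / l (0, 1)) * l (0, 1) = H z * l (0, 1) + ε := by field_simp
    linarith
  rw [hdec x, hdec z] at hle
  rw [inner_smul_left, InnerProductSpace.toDual_symm_apply]
  have hm : m (z - x) = l (z, 0) - l (x, 0) := by
    rw [map_sub]; simp [m]
  rw [hm]
  simp only [conj_trivial]
  have h3 : -(l (0, 1))⁻¹ * (l (z, 0) - l (x, 0)) ≤ H z - H x := by
    rw [neg_mul, ← div_eq_inv_mul, ← neg_div, div_le_iff₀ hpos]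
    nlinarith
  linarith

/-- If `F` lies above a paraboloid at `x` and below an affine function at `x'`, then the two
slopes differ by at most a multiple of `‖x - x'‖`. -/
theorem norm_slope_sub_le {F : E → ℝ} {C : ℝ} {x x' p p' : E}
    (h₁ : ∀ z, F x + ⟪p, z - x⟫ - C * ‖z - x‖ ^ 2 ≤ F z)
    (h₂ : ∀ z, F z ≤ F x' + ⟪p', z - x'⟫)
    (h₃ : F x' ≤ F x + ⟪p, x' - x⟫ + C * ‖x' - x‖ ^ 2) (hC : 0 < C) :
    ‖p - p'‖ ≤ 6 * C * ‖x - x'‖ := by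
  have key : ∀ w : E, ⟪p - p', w⟫ ≤ C * ‖w + (x' - x)‖ ^ 2 + C * ‖x' - x‖ ^ 2 := fun w => by
    have a := h₁ (x' + w)
    have b := h₂ (x' + w)
    have e : x' + w - x = w + (x' - x) := by abel
    rw [e, inner_add_right] at a
    rw [add_sub_cancel_left] at b
    rw [inner_sub_left]
    linarith
  -- With the factor `(3C)⁻¹` the quadratic error is two thirds of the left side and is absorbed.
  -- This leaves `27 C²`, below `(6C)²`.
  have k2 := key ((3 * C)⁻¹ • (p - p'))
  have k3 : ‖(3 * C)⁻¹ • (p - p') + (x' - x)‖ ^ 2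
      ≤ 2 * ((3 * C)⁻¹ * ‖p - p'‖) ^ 2 + 2 * ‖x' - x‖ ^ 2 := by
    have := norm_add_le ((3 * C)⁻¹ • (p - p')) (x' - x)
    rw [norm_smul, Real.norm_of_nonneg (by positivity)] at this
    have h0 := norm_nonneg ((3 * C)⁻¹ • (p - p') + (x' - x))
    nlinarith [sq_nonneg ((3 * C)⁻¹ * ‖p - p'‖ - ‖x' - x‖)]
  rw [inner_smul_right, real_inner_self_eq_norm_sq] at k2
  have k4 : (3 * C)⁻¹ * ‖p - p'‖ ^ 2
      ≤ C * (2 * ((3 * C)⁻¹ * ‖p - p'‖) ^ 2 + 2 * ‖x' - x‖ ^ 2) + C * ‖x' - x‖ ^ 2 := by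
    nlinarith
  have k5 : ‖p - p'‖ ^ 2 ≤ 27 * C ^ 2 * ‖x' - x‖ ^ 2 := by
    have : C * (2 * ((3 * C)⁻¹ * ‖p - p'‖) ^ 2) = (2 / 3) * ((3 * C)⁻¹ * ‖p - p'‖ ^ 2) := by
      field_simp
    have h6 : (3 * C)⁻¹ * ‖p - p'‖ ^ 2 ≤ 9 * C * ‖x' - x‖ ^ 2 := by nlinarith
    rw [inv_mul_le_iff₀ (by positivity)] at h6
    nlinarith
  rw [norm_sub_rev x x']
  refine le_of_sq_le_sq ?_ (by positivity)
  nlinarith [sq_nonneg (C * ‖x' - x‖)]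

/-- Insertion of a convex and semiconcave function between a convex function and a family of
semiconcave functions. -/
theorem exists_convex_semiconcave_between {ι : Type*} [Nonempty ι] {φ : E → ℝ}
    (hφ : ConvexOn ℝ univ φ) {g : ι → E → ℝ} {C : ℝ}
    (hg : ∀ i x z, g i (x + z) + g i (x - z) ≤ 2 * g i x + 2 * C * ‖z‖ ^ 2)
    (hle : ∀ i x, φ x ≤ g i x) :
    ∃ H : E → ℝ, ConvexOn ℝ univ H ∧ (∀ x, φ x ≤ H x) ∧ (∀ i x, H x ≤ g i x) ∧
      ∀ x z, H (x + z) + H (x - z) ≤ 2 * H x + 2 * C * ‖z‖ ^ 2 := by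
  let S : Set (E → ℝ) := {ψ | ConvexOn ℝ univ ψ ∧ ∀ i x, ψ x ≤ g i x}
  have hφS : φ ∈ S := ⟨hφ, hle⟩
  have : Nonempty S := ⟨⟨φ, hφS⟩⟩
  let H : E → ℝ := fun x => ⨆ ψ : S, ψ.1 x
  have hbdd : ∀ x, BddAbove (range fun ψ : S => ψ.1 x) := fun x =>
    ⟨g (Classical.arbitrary ι) x, by rintro _ ⟨ψ, rfl⟩; exact ψ.2.2 _ _⟩
  have hleH : ∀ ψ ∈ S, ∀ x, ψ x ≤ H x := fun ψ hψ x => le_ciSup (hbdd x) ⟨ψ, hψ⟩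
  have hHg : ∀ i x, H x ≤ g i x := fun i x => ciSup_le fun ψ => ψ.2.2 i x
  have hHconv : ConvexOn ℝ univ H := by
    refine ⟨convex_univ, fun x _ y _ a b ha hb hab => ciSup_le fun ψ => ?_⟩
    refine (ψ.2.1.2 (mem_univ x) (mem_univ y) ha hb hab).trans ?_
    simp only [smul_eq_mul]
    gcongr
    · exact hleH _ ψ.2 x
    · exact hleH _ ψ.2 y
  refine ⟨H, hHconv, hleH φ hφS, hHg, fun x z => ?_⟩
  -- `H` is the largest convex function below the family. The averaged translate, lowered by
  -- `C‖z‖²`, is another competitor, so it lies below `H`; this is semiconcavity.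
  have hmem : (fun x => (1 / 2 : ℝ) * H (x + z) + (1 / 2 : ℝ) * H (x + -z) - C * ‖z‖ ^ 2) ∈ S := by
    constructor
    · have h1 : ∀ w, ConvexOn ℝ univ fun x => H (x + w) := fun w => by
        have := hHconv.translate_left w
        rwa [preimage_univ] at this
      have h2 := ((h1 z).smul (c := (1 / 2 : ℝ)) (by norm_num)).add
        ((h1 (-z)).smul (c := (1 / 2 : ℝ)) (by norm_num))
      exact h2.add_const (-(C * ‖z‖ ^ 2))
    · intro i x
      have := hg i x z
      have a := hHg i (x + z)
      have b := hHg i (x - z)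
      rw [sub_eq_add_neg] at this b
      linarith
  have := hleH _ hmem x
  simp only [← sub_eq_add_neg] at this
  linarith

/-- Along differentiability points of its gradient, a function has a second-order expansion. -/
theorem eventually_second_order_expansion [CompleteSpace E] {H : E → ℝ} {q : E → E}
    (hq : ∀ x, HasGradientAt H (q x) x) {A : E →L[ℝ] E} {x : E} (hA : HasFDerivAt q A x)
    {ε : ℝ} (hε : 0 < ε) :
    ∀ᶠ ζ in 𝓝 (0 : E), |H (x + ζ) - H x - ⟪q x, ζ⟫ - ⟪A ζ, ζ⟫ / 2| ≤ ε * ‖ζ‖ ^ 2 := by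
  have h1 : ∀ᶠ ζ in 𝓝 (0 : E), ‖q (x + ζ) - q x - A ζ‖ ≤ ε * ‖ζ‖ := by
    have := (hasFDerivAt_iff_isLittleO_nhds_zero.1 hA).def hε
    exact this
  obtain ⟨r, hr, hball⟩ := Metric.eventually_nhds_iff_ball.1 h1
  refine Metric.eventually_nhds_iff_ball.2 ⟨r, hr, fun ζ hζ => ?_⟩
  let g : ℝ → ℝ := fun t => H (x + t • ζ) - t * ⟪q x, ζ⟫ - t ^ 2 * (⟪A ζ, ζ⟫ / 2)
  have hline : ∀ t : ℝ, HasDerivAt (fun t : ℝ => x + t • ζ) ζ t := fun t => by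
    simpa using ((hasDerivAt_id t).smul_const ζ).const_add x
  have hg : ∀ t : ℝ, HasDerivAt g (⟪q (x + t • ζ) - q x - A (t • ζ), ζ⟫) t := fun t => by
    have a := (hq (x + t • ζ)).hasFDerivAt.comp_hasDerivAt t (hline t)
    have b := (a.sub ((hasDerivAt_id t).mul_const ⟪q x, ζ⟫)).sub
      ((hasDerivAt_pow 2 t).mul_const (⟪A ζ, ζ⟫ / 2))
    refine b.congr_deriv ?_
    simp [inner_sub_left, inner_smul_left]
    ring
  have hmv := (convex_Icc (0 : ℝ) 1).norm_image_sub_le_of_norm_hasDerivWithin_le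
    (f := g) (C := ε * ‖ζ‖ ^ 2) (fun t _ => (hg t).hasDerivWithinAt) (fun t ht => by
      have hb := hball (t • ζ) (by
        rw [mem_ball_zero_iff, norm_smul, Real.norm_of_nonneg ht.1]
        rw [mem_ball_zero_iff] at hζ
        exact (mul_le_of_le_one_left (norm_nonneg _) ht.2).trans_lt hζ)
      calc ‖⟪q (x + t • ζ) - q x - A (t • ζ), ζ⟫‖
          ≤ ‖q (x + t • ζ) - q x - A (t • ζ)‖ * ‖ζ‖ := norm_inner_le_norm _ _
        _ ≤ (ε * ‖t • ζ‖) * ‖ζ‖ := by gcongr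
        _ ≤ (ε * ‖ζ‖) * ‖ζ‖ := by
            rw [norm_smul, Real.norm_of_nonneg ht.1]
            gcongr
            exact mul_le_of_le_one_left (norm_nonneg _) ht.2
        _ = ε * ‖ζ‖ ^ 2 := by ring)
    (left_mem_Icc.2 zero_le_one) (right_mem_Icc.2 zero_le_one)
  simp only [g, Real.norm_eq_abs] at hmv
  norm_num at hmv
  convert hmv using 2
  ring

open MeasureTheory in
/-- A convex function that is also semiconcave has a second-order expansion almost
everywhere. -/
theorem ConvexOn.ae_second_order_expansion [FiniteDimensional ℝ E] [MeasurableSpace E]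
    [BorelSpace E] {H : E → ℝ} (hH : ConvexOn ℝ univ H) {C : ℝ} (hC : 0 < C)
    (hsc : ∀ x z, H (x + z) + H (x - z) ≤ 2 * H x + 2 * C * ‖z‖ ^ 2) :
    ∀ᵐ x ∂(μH[Module.finrank ℝ E] : Measure E), ∃ (p : E) (A : E →L[ℝ] E), ∀ ε > 0,
      ∀ᶠ ζ in 𝓝 (0 : E), |H (x + ζ) - H x - ⟪p, ζ⟫ - ⟪A ζ, ζ⟫ / 2| ≤ ε * ‖ζ‖ ^ 2 := by
  choose q hq using hH.exists_subgradient
  -- Semiconcavity at `x`, with the subgradient inequality at the reflection of `z` through `x`.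
  have hup : ∀ x z, H z ≤ H x + ⟪q x, z - x⟫ + 2 * C * ‖z - x‖ ^ 2 := fun x z => by
    have a := hsc x (z - x)
    have b := hq x (x - (z - x))
    rw [add_sub_cancel] at a
    rw [sub_sub_cancel_left, inner_neg_right] at b
    linarith
  have hgrad : ∀ x, HasGradientAt H (q x) x := fun x => by
    rw [hasGradientAt_iff_isLittleO]
    refine Asymptotics.IsBigO.trans_isLittleO (g := fun z => ‖z - x‖ ^ 2) ?_ ?_
    · refine Asymptotics.IsBigO.of_bound (2 * C) (Eventually.of_forall fun z => ?_)
      rw [Real.norm_of_nonneg (by linarith [hq x z]), Real.norm_of_nonneg (by positivity)]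
      linarith [hup x z]
    · exact Asymptotics.isLittleO_pow_sub_sub x (by norm_num)
  have hlip : LipschitzWith (Real.toNNReal (6 * (2 * C))) q := by
    refine LipschitzWith.of_dist_le_mul fun x x' => ?_
    rw [dist_eq_norm, dist_eq_norm, Real.coe_toNNReal _ (by positivity)]
    have := norm_slope_sub_le (F := fun z => -H z) (C := 2 * C) (x := x) (x' := x')
      (p := -q x) (p' := -q x') (fun z => by rw [inner_neg_left]; linarith [hup x z])
      (fun z => by rw [inner_neg_left]; linarith [hq x' z])
      (by
        rw [inner_neg_left]
        have := hq x x'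
        have : 0 ≤ 2 * C * ‖x' - x‖ ^ 2 := by positivity
        linarith) (by positivity)
    rwa [← neg_sub', norm_neg] at this
  filter_upwards [hlip.ae_differentiableAt (μ := μH[Module.finrank ℝ E])] with x hx
  exact ⟨q x, fderiv ℝ q x, fun ε hε =>
    eventually_second_order_expansion hgrad hx.hasFDerivAt hε⟩

end Convex

/-! ### Doubling of variables and the common second-order jet -/

section Jet

variable {E : Type*} [NormedAddCommGroup E] [InnerProductSpace ℝ E]

local notation "⟪" x ", " y "⟫" => inner ℝ x y

/-- The linearly perturbed penalised difference `a w - b w' - l/2 |z - w|² - l/2 |z - w'|²`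
attains its maximum, and the slope is determined by the maximum point. -/
theorem exists_penalized_max {S : Set E} (hS : IsCompact S) (hne : S.Nonempty) {a b : E → ℝ}
    (ha : UpperSemicontinuousOn a S) (hb : LowerSemicontinuousOn b S) {l : ℝ} (hl : 0 < l)
    (p : E) : ∃ x, ∃ y ∈ S, ∃ y' ∈ S, p = l • (y + y' - (2 : ℝ) • x) ∧
      ∀ z, ∀ w ∈ S, ∀ w' ∈ S,
        a w - b w' - l / 2 * ‖z - w‖ ^ 2 - l / 2 * ‖z - w'‖ ^ 2 - ⟪p, z⟫
          ≤ a y - b y' - l / 2 * ‖x - y‖ ^ 2 - l / 2 * ‖x - y'‖ ^ 2 - ⟪p, x⟫ := by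
  -- For fixed `w`, `w'` the expression is a concave quadratic in `z` with maximiser `X (w, w')`, so
  -- only a maximum over the compact set `S ×ˢ S` is needed.
  let X : E × E → E := fun q => (1 / 2 : ℝ) • (q.1 + q.2) - (2 * l)⁻¹ • p
  let Q : E × E → ℝ := fun q =>
    -(l / 2 * ‖X q - q.1‖ ^ 2) - l / 2 * ‖X q - q.2‖ ^ 2 - ⟪p, X q⟫
  have hXc : Continuous X := by fun_prop
  have hQ : Continuous Q := by fun_prop
  have hXp : ∀ q, p = l • (q.1 + q.2 - (2 : ℝ) • X q) := fun q => by
    simp only [X, smul_sub, smul_smul]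
    have e1 : l * (2 * (2 * l)⁻¹) = 1 := by field_simp
    have e2 : l * (2 * (1 / 2)) = l := by ring
    rw [e1, e2]
    simp
  have husc : UpperSemicontinuousOn (fun q : E × E => (a q.1 + -b q.2) + Q q) (S ×ˢ S) := by
    refine (UpperSemicontinuousOn.add ?_ ?_).add hQ.continuousOn.upperSemicontinuousOn
    · exact ha.comp continuousOn_fst fun q hq => hq.1
    · exact hb.neg.comp continuousOn_snd fun q hq => hq.2
  obtain ⟨q, hq, hmax⟩ := husc.exists_isMaxOn (hne.prod hne) (hS.prod hS)
  refine ⟨X q, q.1, hq.1, q.2, hq.2, hXp q, fun z w hw w' hw' => ?_⟩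
  have h1 := hmax (mk_mem_prod hw hw')
  simp only [mem_ofPred_eq, Q] at h1
  have h2 := hXp (w, w')
  set x := X (w, w')
  have e1 : ‖z - w‖ ^ 2 = ‖x - w‖ ^ 2 + 2 * ⟪x - w, z - x⟫ + ‖z - x‖ ^ 2 := by
    rw [← norm_add_sq_real]; congr 2; abel
  have e2 : ‖z - w'‖ ^ 2 = ‖x - w'‖ ^ 2 + 2 * ⟪x - w', z - x⟫ + ‖z - x‖ ^ 2 := by
    rw [← norm_add_sq_real]; congr 2; abel
  have e3 : ⟪p, z⟫ = ⟪p, x⟫ - l * ⟪x - w, z - x⟫ - l * ⟪x - w', z - x⟫ := by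
    have : ⟪p, z - x⟫ = - l * ⟪x - w, z - x⟫ - l * ⟪x - w', z - x⟫ := by
      rw [h2]
      simp only [inner_smul_left, inner_sub_left, inner_add_left, conj_trivial]
      ring
    rw [inner_sub_right] at this
    linarith
  rw [e1, e2, e3]
  have : 0 ≤ l * ‖z - x‖ ^ 2 := by positivity
  linarith

/-- Nonlinear doubling of variables: near-maximum points of `a y - b y'` at which `a` and `b`
are touched from above resp. below, up to `o(|ζ|²)`, by quadratic polynomials with the same
second-order part. -/
theorem exists_common_second_order_jet [FiniteDimensional ℝ E] {S : Set E} (hS : IsCompact S)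
    {a b : E → ℝ} (ha : UpperSemicontinuousOn a S) (hb : LowerSemicontinuousOn b S)
    {l : ℝ} (hl : 0 < l) {z₀ : E} (hz₀ : z₀ ∈ S) {σ : ℝ} (hσ : 0 < σ) :
    ∃ y ∈ S, ∃ y' ∈ S, a z₀ - b z₀ - σ ≤ a y - b y' - l / 4 * ‖y - y'‖ ^ 2 ∧
      ∃ (A : E →L[ℝ] E) (p p' : E), ∀ ε > 0, ∀ᶠ ζ in 𝓝 (0 : E),
        (y + ζ ∈ S → a (y + ζ) ≤ a y + ⟪p, ζ⟫ + ⟪A ζ, ζ⟫ / 2 + ε * ‖ζ‖ ^ 2) ∧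
        (y' + ζ ∈ S → b y' + ⟪p', ζ⟫ + ⟪A ζ, ζ⟫ / 2 - ε * ‖ζ‖ ^ 2 ≤ b (y' + ζ)) := by
  have hne : S.Nonempty := ⟨z₀, hz₀⟩
  choose x y hy y' hy' hp hmax using fun p => exists_penalized_max hS hne ha hb hl p
  have hexp : ∀ z t w : E,
      ‖z + t - w‖ ^ 2 = ‖z - w‖ ^ 2 + 2 * ⟪z - w, t⟫ + ‖t‖ ^ 2 := fun z t w => by
    rw [← norm_add_sq_real]; congr 2; abel
  -- the sup-convolution of `a` and the inf-convolution of `b`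
  have hUex : ∀ z, ∃ w ∈ S, ∀ w' ∈ S, a w' + -(l / 2 * ‖z - w'‖ ^ 2)
      ≤ a w + -(l / 2 * ‖z - w‖ ^ 2) := fun z => by
    have : UpperSemicontinuousOn (fun w => a w + -(l / 2 * ‖z - w‖ ^ 2)) S :=
      ha.add (by fun_prop : Continuous fun w => -(l / 2 * ‖z - w‖ ^ 2)).continuousOn.upperSemicontinuousOn
    exact this.exists_isMaxOn hne hS
  have hVex : ∀ z, ∃ w ∈ S, ∀ w' ∈ S, b w + l / 2 * ‖z - w‖ ^ 2
      ≤ b w' + l / 2 * ‖z - w'‖ ^ 2 := fun z => by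
    have : LowerSemicontinuousOn (fun w => b w + l / 2 * ‖z - w‖ ^ 2) S :=
      hb.add (by fun_prop : Continuous fun w => l / 2 * ‖z - w‖ ^ 2).continuousOn.lowerSemicontinuousOn
    exact this.exists_isMinOn hne hS
  choose s hsS hs using hUex
  choose t htS ht using hVex
  obtain ⟨U, hU⟩ : ∃ U : E → ℝ, ∀ z, U z = a (s z) + -(l / 2 * ‖z - s z‖ ^ 2) := ⟨_, fun _ => rfl⟩
  obtain ⟨V, hV⟩ : ∃ V : E → ℝ, ∀ z, V z = b (t z) + l / 2 * ‖z - t z‖ ^ 2 := ⟨_, fun _ => rfl⟩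
  have hUle : ∀ z, ∀ w ∈ S, a w - l / 2 * ‖z - w‖ ^ 2 ≤ U z := fun z w hw => by
    rw [hU]; linarith [hs z w hw]
  have hVle : ∀ z, ∀ w ∈ S, V z ≤ b w + l / 2 * ‖z - w‖ ^ 2 := fun z w hw => by
    rw [hV]; exact ht z w hw
  have hUx : ∀ p, U (x p) = a (y p) - l / 2 * ‖x p - y p‖ ^ 2 := fun p => by
    refine le_antisymm ?_ (hUle _ _ (hy p))
    rw [hU]
    linarith [hmax p (x p) (s (x p)) (hsS _) (y' p) (hy' p)]
  have hVx : ∀ p, V (x p) = b (y' p) + l / 2 * ‖x p - y' p‖ ^ 2 := fun p => by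
    refine le_antisymm (hVle _ _ (hy' p)) ?_
    rw [hV]
    linarith [hmax p (x p) (y p) (hy p) (t (x p)) (htS _)]
  have hW : ∀ p z, U z - V z - ⟪p, z⟫ ≤ U (x p) - V (x p) - ⟪p, x p⟫ := fun p z => by
    rw [hUx, hVx, hU, hV]
    linarith [hmax p z (s z) (hsS z) (t z) (htS z)]
  -- the map from slopes to maximum points is antilipschitz
  have hanti : AntilipschitzWith (Real.toNNReal (6 * l)) x := by
    refine AntilipschitzWith.of_le_mul_dist fun p p' => ?_
    rw [dist_eq_norm, dist_eq_norm, Real.coe_toNNReal _ (by positivity)]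
    -- Freezing `y p` and `y' p` puts a paraboloid below `U - V` at `x p`; maximality for `p'` puts
    -- an affine function of slope `p'` above it at `x p'`.
    refine norm_slope_sub_le (F := fun z => U z - V z) (fun z => ?_) (fun z => ?_) ?_ hl
    · have h1 := hUle z _ (hy p)
      have h2 := hVle z _ (hy' p)
      have e1 := hexp (x p) (z - x p) (y p)
      have e2 := hexp (x p) (z - x p) (y' p)
      rw [add_sub_cancel] at e1 e2
      have e3 : ⟪p, z - x p⟫ = - l * ⟪x p - y p, z - x p⟫ - l * ⟪x p - y' p, z - x p⟫ := by
        have := congrArg (fun u => ⟪u, z - x p⟫) (hp p)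
        simp only [inner_smul_left, inner_sub_left, inner_add_left, conj_trivial] at this ⊢
        linarith
      rw [e1] at h1
      rw [e2] at h2
      simp only [hUx, hVx, e3]
      linarith
    · rw [inner_sub_right]
      linarith [hW p' z]
    · rw [inner_sub_right]
      have := hW p (x p')
      have : 0 ≤ l * ‖x p' - x p‖ ^ 2 := by positivity
      linarith
  -- the convex function inserted between the two convolutions
  have hφ : ConvexOn ℝ univ fun z => U z + l / 2 * ‖z‖ ^ 2 := by
    have hsq : ∀ z w : E, l / 2 * ‖z - w‖ ^ 2
        = l / 2 * ‖z‖ ^ 2 - l * ⟪z, w⟫ + l / 2 * ‖w‖ ^ 2 := fun z w => by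
      rw [norm_sub_sq_real]; ring
    refine ⟨convex_univ, fun z₁ _ z₂ _ α β hα hβ hαβ => ?_⟩
    set z := α • z₁ + β • z₂ with hz
    have h1 := mul_le_mul_of_nonneg_left (hUle z₁ _ (hsS z)) hα
    have h2 := mul_le_mul_of_nonneg_left (hUle z₂ _ (hsS z)) hβ
    have h3 := hU z
    have h4 : ∀ w, ⟪z, w⟫ = α * ⟪z₁, w⟫ + β * ⟪z₂, w⟫ := fun w => by
      simp [hz, inner_add_left, inner_smul_left]
    rw [hsq] at h1 h2 h3
    rw [h4] at h3
    have hβ' : β = 1 - α := by linarith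
    simp only [smul_eq_mul]
    subst hβ'
    linarith
  -- Indexing by all slopes at once makes `H` independent of `p`, so its exceptional null set is
  -- fixed before `p` is chosen.
  obtain ⟨H, hHc, hφH, hHg, hHsc⟩ := exists_convex_semiconcave_between (ι := E) hφ
    (g := fun p z => V z + l / 2 * ‖z‖ ^ 2 + ⟪p, z⟫ + (U (x p) - V (x p) - ⟪p, x p⟫)) (C := l)
    (fun p z ζ => by
      have h1 := hVle (z + ζ) _ (htS z)
      have h2 := hVle (z - ζ) _ (htS z)
      have h3 := hV z
      have e1 := hexp z ζ (t z)
      have e2 := hexp z (-ζ) (t z)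
      rw [← sub_eq_add_neg, inner_neg_right, norm_neg] at e2
      rw [e1] at h1
      rw [e2] at h2
      simp only [norm_add_sq_real, norm_sub_sq_real, inner_add_right, inner_sub_right]
      linarith)
    (fun p z => by linarith [hW p z])
  -- choice of the slope
  obtain ⟨R, hR, hSR⟩ := hS.isBounded.exists_pos_norm_le
  -- The bound `1` gives `‖z₀ - x p‖ ≤ 2R + (2l)⁻¹`; the other bound then keeps the error from the
  -- linear term below `σ`.
  obtain ⟨p, hpr, q, A, hA⟩ : ∃ p ∈ Metric.ball (0 : E) (min 1 (σ / (2 * R + (2 * l)⁻¹))), ∃ (q : E)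
      (A : E →L[ℝ] E), ∀ ε > 0, ∀ᶠ ζ in 𝓝 (0 : E),
        |H (x p + ζ) - H (x p) - ⟪q, ζ⟫ - ⟪A ζ, ζ⟫ / 2| ≤ ε * ‖ζ‖ ^ 2 := by
    borelize E
    exact exists_mem_ball_of_antilipschitz hanti (by positivity)
      (hHc.ae_second_order_expansion hl hHsc)
  rw [mem_ball_zero_iff, lt_min_iff] at hpr
  have hHx : H (x p) = U (x p) + l / 2 * ‖x p‖ ^ 2 :=
    le_antisymm (by linarith [hHg p (x p)]) (hφH (x p))
  -- Subtracting `l/2‖z‖²` from `H` shifts its jet by `-l • id` and `-l • x p`; the extra `-p` for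
  -- `b` comes from the affine term.
  refine ⟨y p, hy p, y' p, hy' p, ?_, A - l • ContinuousLinearMap.id ℝ E,
    q - l • x p, q - l • x p - p, fun ε hε => ?_⟩
  · have h1 := hmax p z₀ z₀ hz₀ z₀ hz₀
    have h2 : ⟪p, z₀ - x p⟫ ≤ σ := by
      have e : z₀ - x p = (1 / 2 : ℝ) • (z₀ - y p) + (1 / 2 : ℝ) • (z₀ - y' p)
          + (2 * l)⁻¹ • p := by
        have e' := congrArg (fun u => (2 * l)⁻¹ • u) (hp p)
        simp only [smul_smul, show (2 * l)⁻¹ * l = 1 / 2 by field_simp] at e'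
        rw [e']
        module
      have hn : ‖z₀ - x p‖ ≤ 2 * R + (2 * l)⁻¹ := by
        have hz := hSR _ hz₀
        have n1 : ‖z₀ - y p‖ ≤ 2 * R := (norm_sub_le _ _).trans (by linarith [hSR _ (hy p)])
        have n2 : ‖z₀ - y' p‖ ≤ 2 * R := (norm_sub_le _ _).trans (by linarith [hSR _ (hy' p)])
        have n3 : (2 * l)⁻¹ * ‖p‖ ≤ (2 * l)⁻¹ := mul_le_of_le_one_right (by positivity) hpr.1.le
        rw [e]
        refine norm_add₃_le.trans ?_
        simp only [norm_smul, Real.norm_of_nonneg (by positivity : (0 : ℝ) ≤ (2 * l)⁻¹),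
          Real.norm_of_nonneg (by norm_num : (0 : ℝ) ≤ 1 / 2)]
        linarith
      have h3 := (lt_div_iff₀ (by positivity)).1 hpr.2
      calc ⟪p, z₀ - x p⟫ ≤ ‖p‖ * ‖z₀ - x p‖ := real_inner_le_norm _ _
        _ ≤ ‖p‖ * (2 * R + (2 * l)⁻¹) := by gcongr
        _ ≤ σ := h3.le
    rw [inner_sub_right] at h2
    simp only [sub_self, norm_zero] at h1
    have h4 : ‖y p - y' p‖ ^ 2 ≤ 2 * ‖x p - y p‖ ^ 2 + 2 * ‖x p - y' p‖ ^ 2 := by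
      have h5 := norm_sub_le_norm_sub_add_norm_sub (y p) (x p) (y' p)
      rw [norm_sub_rev (y p) (x p)] at h5
      nlinarith [sq_nonneg (‖x p - y p‖ - ‖x p - y' p‖), norm_nonneg (y p - y' p)]
    nlinarith
  · filter_upwards [hA ε hε] with ζ hζ
    rw [abs_le] at hζ
    have hsq := norm_add_sq_real (x p) ζ
    have hin : ⟪(A - l • ContinuousLinearMap.id ℝ E) ζ, ζ⟫ = ⟪A ζ, ζ⟫ - l * ‖ζ‖ ^ 2 := by
      simp [inner_sub_left, inner_smul_left]
    rw [hin]
    simp only [inner_sub_left, inner_smul_left, conj_trivial]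
    constructor
    · intro hmem
      -- Moving `y p` and `x p` by the same `ζ` leaves the penalty unchanged, so the jet of `H` at
      -- `x p` passes to `a` at `y p`.
      have h1 := hUle (x p + ζ) _ hmem
      have h2 := hφH (x p + ζ)
      rw [add_sub_add_right_eq_sub] at h1
      simp only [hsq] at h2
      linarith [hUx p]
    · intro hmem
      have h1 := hVle (x p + ζ) _ hmem
      have h2 := hHg p (x p + ζ)
      rw [add_sub_add_right_eq_sub] at h1
      simp only [hsq, inner_add_right] at h2
      linarith [hVx p]

end Jet

/-! ### Quadratic test functions and ellipticity -/

/-- The quadratic polynomial `α + ℓ (z - y) + B (z - y) (z - y) / 2` centred at `y`. -/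
noncomputable def quadraticAt {E : Type*} [NormedAddCommGroup E] [NormedSpace ℝ E] (y : E) (α : ℝ)
    (ℓ : E →L[ℝ] ℝ) (B : E →L[ℝ] E →L[ℝ] ℝ) (z : E) : ℝ :=
  α + ℓ (z - y) + B (z - y) (z - y) / 2

theorem contDiff_quadraticAt {E : Type*} [NormedAddCommGroup E] [NormedSpace ℝ E] (y : E)
    (α : ℝ) (ℓ : E →L[ℝ] ℝ) (B : E →L[ℝ] E →L[ℝ] ℝ) :
    ContDiff ℝ 2 (quadraticAt y α ℓ B) := by
  unfold quadraticAt
  fun_prop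

theorem fderiv_fderiv_quadraticAt {E : Type*} [NormedAddCommGroup E] [NormedSpace ℝ E] (y : E)
    (α : ℝ) (ℓ : E →L[ℝ] ℝ) (B : E →L[ℝ] E →L[ℝ] ℝ) (z h k : E) :
    fderiv ℝ (fderiv ℝ (quadraticAt y α ℓ B)) z h k = (B h k + B k h) / 2 := by
  have h1 : fderiv ℝ (quadraticAt y α ℓ B)
      = fun z => ℓ + (1 / 2 : ℝ) • (B + B.flip) (z - y) := by
    funext z
    have hs : HasFDerivAt (fun z : E => z - y) (ContinuousLinearMap.id ℝ E) z :=
      (hasFDerivAt_id z).sub_const y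
    have hl := (ℓ.hasFDerivAt (x := z - y)).comp z hs
    have hb := B.hasFDerivAt_of_bilinear hs hs
    have := ((hl.const_add α).add (hb.const_mul (1 / 2 : ℝ))).fderiv
    have e : quadraticAt y α ℓ B
        = ((fun z => α + (ℓ ∘ fun z => z - y) z) + fun z => 1 / 2 * B (z - y) (z - y)) := by
      funext z; simp [quadraticAt]; ring
    rw [e, this]
    ext k
    simp
  rw [h1]
  have h2 : HasFDerivAt (fun z => ℓ + (1 / 2 : ℝ) • (B + B.flip) (z - y))
      ((1 / 2 : ℝ) • (B + B.flip)) z := by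
    have hs : HasFDerivAt (fun z : E => z - y) (ContinuousLinearMap.id ℝ E) z :=
      (hasFDerivAt_id z).sub_const y
    have := ((B + B.flip).hasFDerivAt (x := z - y)).comp z hs
    exact (this.const_smul (1 / 2 : ℝ)).const_add ℓ
  rw [h2.fderiv]
  simp
  ring

/-- The real bilinear form `⟪A h, k⟫ + 2 κ ⟪h, k⟫`. -/
noncomputable def shiftedForm {n : ℕ} (A : Cn n →L[ℝ] Cn n) (κ : ℝ) : Cn n →L[ℝ] Cn n →L[ℝ] ℝ :=
  (innerSL ℝ).comp (A + (2 * κ) • ContinuousLinearMap.id ℝ (Cn n))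

theorem shiftedForm_apply {n : ℕ} (A : Cn n →L[ℝ] Cn n) (κ : ℝ) (h k : Cn n) :
    shiftedForm A κ h k = inner ℝ (A h) k + 2 * κ * inner ℝ h k := by
  change inner ℝ (A h + (2 * κ) • h) k = _
  rw [inner_add_left, real_inner_smul_left]

theorem shiftedForm_self {n : ℕ} (A : Cn n →L[ℝ] Cn n) (κ : ℝ) (h : Cn n) :
    shiftedForm A κ h h / 2 = inner ℝ (A h) h / 2 + κ * ‖h‖ ^ 2 := by
  rw [shiftedForm_apply, real_inner_self_eq_norm_sq]; ring

/-- The contributions of `A` agree, and `‖z‖²` has complex Hessian the identity, so only the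
difference of the coefficients `κ` survives. -/
theorem complexHessianMatrix_quadraticAt_shift {n : ℕ} (y y' : Cn n) (α α' : ℝ)
    (ℓ ℓ' : Cn n →L[ℝ] ℝ) (A : Cn n →L[ℝ] Cn n) (κ κ' : ℝ) (z z' : Cn n) :
    complexHessianMatrix (quadraticAt y' α' ℓ' (shiftedForm A κ')) z'
      = complexHessianMatrix (quadraticAt y α ℓ (shiftedForm A κ)) z
        + ((κ' - κ : ℝ) : ℂ) • (1 : Matrix (Fin n) (Fin n) ℂ) := by
  ext j k
  have hXX : (inner ℝ (dirX j : Cn n) (dirX k) : ℝ) = if j = k then 1 else 0 := by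
    simp only [dirX, PiLp.inner_apply, Complex.inner, PiLp.single_apply]
    rw [Finset.sum_eq_single k (by simp +contextual) (by simp)]
    by_cases h : j = k <;> simp [h, eq_comm]
  have hYY : (inner ℝ (dirY j : Cn n) (dirY k) : ℝ) = if j = k then 1 else 0 := by
    simp only [dirY, PiLp.inner_apply, Complex.inner, PiLp.single_apply]
    rw [Finset.sum_eq_single k (by simp +contextual) (by simp)]
    by_cases h : j = k <;> simp [h, eq_comm]
  have hXY : ∀ j k : Fin n, (inner ℝ (dirX j : Cn n) (dirY k) : ℝ) = 0 := fun j k => by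
    simp only [dirX, dirY, PiLp.inner_apply, Complex.inner, PiLp.single_apply]
    rw [Finset.sum_eq_single k (by simp +contextual) (by simp)]
    by_cases h : j = k <;> simp [h, eq_comm]
  have hYX : ∀ j k : Fin n, (inner ℝ (dirY j : Cn n) (dirX k) : ℝ) = 0 := fun j k => by
    rw [real_inner_comm, hXY]
  simp only [complexHessianMatrix, realD2, fderiv_fderiv_quadraticAt, shiftedForm_apply,
    Matrix.of_apply, Matrix.add_apply, Matrix.smul_apply, Matrix.one_apply,
    real_inner_comm (dirX j : Cn n) (dirX k), real_inner_comm (dirY j : Cn n) (dirY k),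
    hXX, hYY, hXY, hYX, smul_eq_mul]
  split_ifs <;> push_cast <;> ring

/-- The real scalar matrix `t • 1` as a Hermitian matrix. -/
def scalarHerm (n : ℕ) (t : ℝ) : Herm n :=
  ⟨(t : ℂ) • (1 : Matrix (Fin n) (Fin n) ℂ), by
    rw [selfAdjoint.mem_iff, star_smul, star_one, Complex.star_def, Complex.conj_ofReal]⟩

theorem posDef_scalarHerm {n : ℕ} {t : ℝ} (ht : 0 < t) :
    (scalarHerm n t : Matrix (Fin n) (Fin n) ℂ).PosDef :=
  Matrix.PosDef.one.smul (by exact_mod_cast ht)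

theorem lambdaOne_scalarHerm {n : ℕ} (hn : 1 ≤ n) (t : ℝ) : lambdaOne (scalarHerm n t) = t := by
  have : Nonempty (Fin n) := ⟨⟨0, hn⟩⟩
  have hev : ∀ i, (show (scalarHerm n t : Matrix (Fin n) (Fin n) ℂ).IsHermitian from
      (scalarHerm n t).2).eigenvalues i = t := fun i => by
    set hA : (scalarHerm n t : Matrix (Fin n) (Fin n) ℂ).IsHermitian := (scalarHerm n t).2
    have h1 := hA.mulVec_eigenvectorBasis i
    have h2 : (hA.eigenvectorBasis i).ofLp ≠ 0 := fun h =>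
      hA.eigenvectorBasis.orthonormal.ne_zero i (by ext j; exact congrFun h j)
    obtain ⟨j, hj⟩ := Function.ne_iff.1 h2
    have h3 := congrFun h1 j
    simp only [scalarHerm, Matrix.smul_mulVec, Matrix.one_mulVec, Pi.smul_apply, smul_eq_mul,
      Complex.real_smul] at h3
    exact_mod_cast (mul_right_cancel₀ hj h3).symm
  simp only [lambdaOne, hev, ciInf_const]

/-- Ellipticity passes to the closure. -/
theorem ellipticity_on_closure {n : ℕ} {𝒞 : Set (Herm n)} {G : Herm n → ℝ}
    (hG : ContinuousOn G (closure 𝒞)) {P : Herm n} {r : ℝ}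
    (h : ∀ A ∈ 𝒞, A + P ∈ closure 𝒞 ∧ r ≤ G (A + P) - G A) {A : Herm n} (hA : A ∈ closure 𝒞) :
    A + P ∈ closure 𝒞 ∧ r ≤ G (A + P) - G A := by
  have hmaps : MapsTo (fun A : Herm n => A + P) (closure 𝒞) (closure 𝒞) := by
    have : MapsTo (fun A : Herm n => A + P) 𝒞 (closure 𝒞) := fun A hA => (h A hA).1
    simpa using this.closure (continuous_add_const P)
  refine ⟨hmaps hA, ?_⟩
  have hcont : ContinuousOn (fun A => G (A + P) - G A) (closure 𝒞) :=
    (hG.comp (continuous_add_const P).continuousOn hmaps).sub hG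
  have : (𝓝[𝒞] A).NeBot := mem_closure_iff_nhdsWithin_neBot.1 hA
  exact ge_of_tendsto ((hcont A hA).mono_left (nhdsWithin_mono _ subset_closure))
    (eventually_mem_nhdsWithin.mono fun B hB => (h B hB).2)

/-- Points of a compact set where `a y - b y'` is not small and that are close to each other
are close to the diagonal in any quantitative sense which holds on the diagonal. -/
theorem exists_pos_dist_of_usc {E : Type*} [MetricSpace E] {S : Set E} (hS : IsCompact S)
    {a b : E → ℝ} (ha : UpperSemicontinuousOn a S) (hb : LowerSemicontinuousOn b S) {μ : ℝ}
    {T : Set (E × E)} (hT : IsClosed ((S ×ˢ S) \ T))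
    (hdiag : ∀ y ∈ S, μ ≤ a y - b y → (y, y) ∈ T) :
    ∃ ρ > 0, ∀ y ∈ S, ∀ y' ∈ S, μ ≤ a y - b y' → dist y y' < ρ → (y, y') ∈ T := by
  have husc : UpperSemicontinuousOn (fun q : E × E => a q.1 + -b q.2) (S ×ˢ S) :=
    (ha.comp continuousOn_fst fun q hq => hq.1).add
      (hb.neg.comp continuousOn_snd fun q hq => hq.2)
  have hbad := (hS.prod hS).of_isClosed_subset hT sdiff_subset
  -- The offending pairs form a compact set missing the diagonal, so their distance has a positive
  -- minimum.
  have hK := (husc.mono sdiff_subset).isCompact_inter_preimage_Ici hbad μ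
  obtain ⟨ρ, hρ, hlt⟩ : ∃ ρ > 0, ∀ q ∈ ((S ×ˢ S) \ T) ∩ (fun q => a q.1 + -b q.2) ⁻¹' Ici μ,
      ρ ≤ dist q.1 q.2 := by
    rcases (((S ×ˢ S) \ T) ∩ (fun q => a q.1 + -b q.2) ⁻¹' Ici μ).eq_empty_or_nonempty with h | h
    · exact ⟨1, one_pos, by simp [h]⟩
    · obtain ⟨q, hq, hmin⟩ := hK.exists_isMinOn h continuous_dist.continuousOn
      refine ⟨dist q.1 q.2, dist_pos.2 fun he => ?_, fun q' hq' => hmin hq'⟩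
      refine hq.1.2 ?_
      have h1 := hdiag q.1 hq.1.1.1 (by
        have := hq.2
        rw [mem_preimage, mem_Ici, ← he] at this
        linarith)
      rwa [show q = (q.1, q.1) from Prod.ext rfl he.symm]
  refine ⟨ρ, hρ, fun y hy y' hy' hμ hd => ?_⟩
  by_contra hn
  exact (hlt (y, y') ⟨⟨⟨hy, hy'⟩, hn⟩, by simpa [sub_eq_add_neg] using hμ⟩).not_gt hd

/-! ### Comparison principle -/

theorem mainTheorem4 (n : ℕ) (hn : 1 ≤ n)
    (Ω : Set (Cn n)) (hΩ_open : IsOpen Ω) (hΩ_conn : IsConnected Ω)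
    (hΩ_bdd : Bornology.IsBounded Ω)
    (f : Cn n → ℝ) (hf_cont : ContinuousOn f (closure Ω)) (hf_pos : ∀ z ∈ closure Ω, 0 < f z)
    (𝒞 : Set (Herm n)) (h𝒞_open : IsOpen 𝒞)
    (h𝒞_cone : ∀ t : ℝ, 0 < t → ∀ A ∈ 𝒞, t • A ∈ 𝒞)
    (h𝒞_pos : ∀ P : Herm n, (P : Matrix (Fin n) (Fin n) ℂ).PosDef → P ∈ 𝒞)
    (G : Herm n → ℝ) (hG_cont : ContinuousOn G (closure 𝒞))
    (hG_comp : ∃ c : ℝ, 0 < c ∧ ∀ A ∈ 𝒞, ∀ P : Herm n,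
      (P : Matrix (Fin n) (Fin n) ℂ).PosDef →
        A + P ∈ closure 𝒞 ∧ c * lambdaOne P ≤ G (A + P) - G A)
    (u v : Cn n → ℝ)
    (hu_bdd : ∃ M : ℝ, ∀ z ∈ Ω, |u z| ≤ M) (hv_bdd : ∃ M : ℝ, ∀ z ∈ Ω, |v z| ≤ M)
    (hu_usc : UpperSemicontinuousOn u (closure Ω))
    (hv_lsc : LowerSemicontinuousOn v (closure Ω))
    (hu : IsViscositySubsolution 𝒞 G f Ω u)
    (hv : IsViscositySupersolution 𝒞 G f Ω v)
    (huv : ∀ z ∈ frontier Ω, u z ≤ v z) :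
    ∀ z ∈ Ω, u z ≤ v z := by

  intro z₀ hz₀
  by_contra! hlt
  obtain ⟨c, hc, hG_ell⟩ := hG_comp
  have hS : IsCompact (closure Ω) := hΩ_bdd.isCompact_closure
  obtain ⟨R, hR, hSR⟩ := hS.isBounded.exists_pos_norm_le
  obtain ⟨m, hm⟩ : ∃ m, m = u z₀ - v z₀ := ⟨_, rfl⟩
  have hm0 : 0 < m := by linarith
  -- On the frontier `a - v ≤ δ R² ≤ m/4`, below the threshold `m/2` used for near-maximum points.
  obtain ⟨δ, hδ0, hδ⟩ : ∃ δ > 0, δ * R ^ 2 ≤ m / 4 :=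
    ⟨m / 4 / R ^ 2, by positivity, by rw [div_mul_cancel₀ _ (by positivity)]⟩
  obtain ⟨a, ha⟩ : ∃ a : Cn n → ℝ, ∀ z, a z = u z + δ * ‖z‖ ^ 2 := ⟨_, fun _ => rfl⟩
  have ha_usc : UpperSemicontinuousOn a (closure Ω) := by
    rw [funext ha]
    exact hu_usc.add
      (by fun_prop : Continuous fun z : Cn n => δ * ‖z‖ ^ 2).continuousOn.upperSemicontinuousOn
  -- near-diagonal points with `m / 2 ≤ a y - v y'` are interior
  let T : Set (Cn n × Cn n) :=
    {q | q.1 ∈ Ω ∧ q.2 ∈ Ω ∧ |f q.1 - f q.2| < c * (δ / 2)}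
  have hT : IsClosed ((closure Ω ×ˢ closure Ω) \ T) := by
    have e : (closure Ω ×ˢ closure Ω) \ T = (closure Ω ×ˢ closure Ω) ∩
        ((Prod.fst ⁻¹' Ωᶜ ∪ Prod.snd ⁻¹' Ωᶜ)) ∪ (closure Ω ×ˢ closure Ω) ∩
          (fun q => |f q.1 - f q.2|) ⁻¹' Ici (c * (δ / 2)) := by
      ext q
      simp only [T, Set.mem_sdiff, mem_ofPred_eq, mem_union, mem_inter_iff, mem_preimage, mem_compl_iff,
        mem_Ici, not_and_or, not_lt]
      tauto
    rw [e]
    have hcl : IsClosed (closure Ω ×ˢ closure Ω) := isClosed_closure.prod isClosed_closure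
    refine (hcl.inter ((hΩ_open.isClosed_compl.preimage continuous_fst).union
      (hΩ_open.isClosed_compl.preimage continuous_snd))).union ?_
    refine ContinuousOn.preimage_isClosed_of_isClosed ?_ hcl isClosed_Ici
    exact ((hf_cont.comp continuousOn_fst fun q hq => hq.1).sub
      (hf_cont.comp continuousOn_snd fun q hq => hq.2)).abs
  obtain ⟨ρ, hρ, hnear⟩ := exists_pos_dist_of_usc hS ha_usc hv_lsc (μ := m / 2) hT (by
    intro y hy hμ
    have hyΩ : y ∈ Ω := by
      by_contra hn
      have h1 := huv y ⟨hy, by rwa [hΩ_open.interior_eq]⟩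
      have h2 : δ * ‖y‖ ^ 2 ≤ δ * R ^ 2 := by gcongr; exact hSR y hy
      rw [ha] at hμ
      linarith
    exact ⟨hyΩ, hyΩ, by simpa using by positivity⟩)
  obtain ⟨Ma, hMa⟩ := ha_usc.bddAbove_of_isCompact hS
  obtain ⟨Mv, hMv⟩ := hv_lsc.bddBelow_of_isCompact hS
  -- A penalty this strong forces `‖y - y'‖ < ρ`.
  obtain ⟨l, hl, hlρ⟩ : ∃ l > 0, Ma - Mv < l / 4 * ρ ^ 2 := by
    refine ⟨4 * (|Ma - Mv| + 1) / ρ ^ 2, by positivity, ?_⟩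
    have : 4 * (|Ma - Mv| + 1) / ρ ^ 2 / 4 * ρ ^ 2 = |Ma - Mv| + 1 := by field_simp
    rw [this]
    linarith [le_abs_self (Ma - Mv)]
  obtain ⟨y, hy, y', hy', hyy, A, p, p', hjet⟩ := exists_common_second_order_jet hS ha_usc hv_lsc
    hl (subset_closure hz₀) (half_pos hm0)
  have haz : a z₀ - v z₀ ≥ m := by
    have : 0 ≤ δ * ‖z₀‖ ^ 2 := by positivity
    rw [ha]
    linarith
  have hMa' := hMa (mem_image_of_mem a hy)
  have hMv' := hMv (mem_image_of_mem v hy')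
  have hnn : 0 ≤ l / 4 * ‖y - y'‖ ^ 2 := by positivity
  obtain ⟨hyΩ, hyΩ', hff⟩ : (y, y') ∈ T := by
    refine hnear y hy y' hy' (by linarith) ?_
    rw [dist_eq_norm]
    have h1 : l / 4 * ‖y - y'‖ ^ 2 < l / 4 * ρ ^ 2 := by linarith
    exact lt_of_pow_lt_pow_left₀ 2 hρ.le (lt_of_mul_lt_mul_left h1 (by positivity))
  -- quadratic test functions
  have hsub : ∀ w : Cn n, Tendsto (fun z => z - w) (𝓝 w) (𝓝 0) := fun w => by
    have : Continuous fun z : Cn n => z - w := by fun_prop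
    simpa using this.tendsto w
  have hev := hjet (δ / 4) (by positivity)
  -- The `-δ` removes the perturbation `δ‖z‖²` from `a`; the `δ/4` here and in `ψ` absorbs the
  -- `o(‖ζ‖²)` errors. A surplus of `δ/2` remains.
  let φ := quadraticAt y (u y) (innerSL ℝ (p - (2 * δ) • y)) (shiftedForm A (δ / 4 - δ))
  let ψ := quadraticAt y' (v y') (innerSL ℝ p') (shiftedForm A (-(δ / 4)))
  have hφC : ContDiffAt ℝ 2 φ y := (contDiff_quadraticAt _ _ _ _).contDiffAt
  have hψC : ContDiffAt ℝ 2 ψ y' := (contDiff_quadraticAt _ _ _ _).contDiffAt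
  have hφt : TouchesFromAbove φ u y := by
    refine ⟨by simp [φ, quadraticAt], ?_⟩
    filter_upwards [(hsub y).eventually hev, hΩ_open.mem_nhds hyΩ] with z hz hzΩ
    have h1 := hz.1 (by simpa using subset_closure hzΩ)
    rw [add_sub_cancel, ha, ha] at h1
    have h2 : ‖z‖ ^ 2 = ‖y‖ ^ 2 + 2 * inner ℝ y (z - y) + ‖z - y‖ ^ 2 := by
      rw [← norm_add_sq_real, add_sub_cancel]
    simp only [φ, quadraticAt, shiftedForm_self]
    rw [innerSL_apply_apply, inner_sub_left, real_inner_smul_left]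
    rw [h2] at h1
    linarith
  have hψt : TouchesFromBelow ψ v y' := by
    refine ⟨by simp [ψ, quadraticAt], ?_⟩
    filter_upwards [(hsub y').eventually hev, hΩ_open.mem_nhds hyΩ'] with z hz hzΩ
    have h1 := hz.2 (by simpa using subset_closure hzΩ)
    rw [add_sub_cancel] at h1
    simp only [ψ, quadraticAt, shiftedForm_self]
    rw [innerSL_apply_apply]
    linarith
  obtain ⟨hXc, hXf⟩ := hu.test y hyΩ φ hφC hφt
  have hY : complexHessian ψ y' hψC = complexHessian φ y hφC + scalarHerm n (δ / 2) := by
    apply Subtype.ext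
    refine (complexHessianMatrix_quadraticAt_shift y y' (u y) _ (innerSL ℝ (p - (2 * δ) • y)) _ A
      (δ / 4 - δ) _ y y').trans ?_
    rw [show -(δ / 4) - (δ / 4 - δ) = δ / 2 by ring]
    rfl
  have hP := posDef_scalarHerm (n := n) (half_pos hδ0)
  -- The subsolution test places the Hessian of `φ` only in `closure 𝒞`. Ellipticity there both
  -- makes `ψ` admissible for the supersolution test and yields the gain `c * (δ / 2)`.
  obtain ⟨hYc, hYG⟩ := ellipticity_on_closure hG_cont
    (fun B hB => hG_ell B hB _ hP) hXc
  rw [lambdaOne_scalarHerm hn, ← hY] at hYG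
  rw [← hY] at hYc
  have hYf := hv.test y' hyΩ' ψ hψC hψt hYc
  linarith [(abs_lt.1 hff).1]
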